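/- Let $a\ge 1$ be an integer. Consider the diagonal random walk on $\mathbb Z^2$ started at $(a,0)$: in each step the walker at $(p,s)$ with $p\ge 1$ moves to one of the four points $(p\pm1,s\pm1)$, each with probability $\tfrac14$, independently of the past; the walker is absorbed (stays for ever) when it reaches the boundary $p=0$. Let $F_{(a,0)}(p,s)$ be the expected number of departures from $(p,s)$, that is, of times at which the walker is at $(p,s)$ and moves away in the next step. For $\lambda\in(0,\pi)$, $\lambda\ne\pi/2$, let $\mu=\mu(\lambda)\in\mathbb C$ be a solution of $\cos\lambda\cosh\mu=1$ with $\operatorname{Re}\mu>0$. Such a solution exists (for $\lambda>\pi/2$ it is not real), and for every choice of it the following holds. (i) For all integers $p\ge 0$ and $s$, the integral below converges absolutely, $F_{(a,0)}(p,s)$ is finite, and $$F_{(a,0)}(p,s)=\frac{2}{\pi}\int_0^\pi \frac{\sin(a\lambda)\,\sin(p\lambda)\,e^{-|s|\mu}}{\tanh\mu}\,d\lambda .$$ (ii) The right-hand side, as a function $F$ of $(p,s)$, is bounded on $\{p\ge 0\}$ and satisfies $$F(p,s)=\delta_{a,p}\,\delta_{0,s}+\tfrac14\{F(p+1,s+1)+F(p+1,s-1)+F(p-1,s+1)+F(p-1,s-1)\}\qquad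 (p\ge 1,\ s\in\mathbb Z)$$ together with the boundary condition $F(0,s)=0$ for all $s\in\mathbb Z$. (iii) It is the unique bounded solution: every bounded complex-valued function on $\{(p,s)\in\mathbb Z^2: p\ge 0\}$ that satisfies this difference equation and boundary condition equals $F$. -/

import Mathlib

open MeasureTheory ProbabilityTheory
open scoped ENNReal

noncomputable section

namespace DiagonalWalk

/-- The steps of a diagonal walk: independent, each of them uniformly distributed on the four
vectors `(±1, ±1)`. -/
structure IsDiagonalSteps {Ω : Type*} [MeasurableSpace Ω] (P : Measure Ω)
    (ξ : ℕ → Ω → ℤ × ℤ) : Prop where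
  measurable : ∀ n, Measurable (ξ n)
  indep : iIndepFun ξ P
  law : ∀ n (e : ℤ × ℤ), |e.1| = 1 → |e.2| = 1 → P (ξ n ⁻¹' {e}) = 1 / 4

/-- The walk with steps `ξ` started at `x₀`: it moves as long as it is in the interior `p ≥ 1`
of the half-plane, and it stays for ever where it first meets the boundary. -/
def walk {Ω : Type*} (ξ : ℕ → Ω → ℤ × ℤ) (x₀ : ℤ × ℤ) : ℕ → Ω → ℤ × ℤ
  | 0, _ => x₀
  | n + 1, ω => if 1 ≤ (walk ξ x₀ n ω).1 then walk ξ x₀ n ω + ξ n ω else walk ξ x₀ n ω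

open Classical in
/-- The number of departures of the walk from the point `y`: the number of times `n` at which the
walk is at `y` and moves away from `y` in its next step. -/
def departures {Ω : Type*} (ξ : ℕ → Ω → ℤ × ℤ) (x₀ y : ℤ × ℤ) (ω : Ω) : ℝ≥0∞ :=
  ∑' n : ℕ, if walk ξ x₀ n ω = y ∧ walk ξ x₀ (n + 1) ω ≠ y then 1 else 0

/-- The expected number of departures from `y` when starting in `x₀`. -/
def expectedDepartures {Ω : Type*} [MeasurableSpace Ω] (P : Measure Ω)
    (ξ : ℕ → Ω → ℤ × ℤ) (x₀ y : ℤ × ℤ) : ℝ≥0∞ :=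
  ∫⁻ ω, departures ξ x₀ y ω ∂P

/-- `μ` solves `cos θ * cosh (μ θ) = 1` on `(0, π)`, with positive real part. The values are
complex because `cos θ < 0` for `θ > π / 2`; there is no solution at `θ = π / 2`. -/
def IsBranch (μ : ℝ → ℂ) : Prop :=
  ∀ θ ∈ Set.Ioo 0 Real.pi, θ ≠ Real.pi / 2 →
    Complex.cos (θ : ℂ) * Complex.cosh (μ θ) = 1 ∧ 0 < (μ θ).re

/-- The integrand `sin (a θ) sin (p θ) exp (-|s| μ) / tanh μ`. -/
def integrand (μ : ℝ → ℂ) (a p s : ℤ) (θ : ℝ) : ℂ :=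
  Complex.sin ((a : ℂ) * (θ : ℂ)) * Complex.sin ((p : ℂ) * (θ : ℂ)) *
    Complex.exp (-((|s| : ℤ) : ℂ) * μ θ) / Complex.tanh (μ θ)

/-- The right-hand side of the integral formula. -/
def formula (μ : ℝ → ℂ) (a p s : ℤ) : ℂ :=
  2 / (Real.pi : ℂ) * ∫ θ in (0 : ℝ)..Real.pi, integrand μ a p s θ

/-- `G` satisfies the difference equation with source `(a, 0)` in the interior `p ≥ 1` and
vanishes on the boundary `p = 0`. -/
structure IsSolution (a : ℤ) (G : ℤ → ℤ → ℂ) : Prop where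
  interior : ∀ p s : ℤ, 1 ≤ p →
    G p s = (if a = p then 1 else 0) * (if (0 : ℤ) = s then 1 else 0) +
      1 / 4 * (G (p + 1) (s + 1) + G (p + 1) (s - 1) + G (p - 1) (s + 1) + G (p - 1) (s - 1))
  boundary : ∀ s : ℤ, G 0 s = 0

/-- `G` is bounded on the closed half-plane `p ≥ 0`. -/
def IsBoundedOnHalfPlane (G : ℤ → ℤ → ℂ) : Prop :=
  ∃ C : ℝ, ∀ p s : ℤ, 0 ≤ p → ‖G p s‖ ≤ C

end DiagonalWalk

end

/-! On every branch, exp(-μ) = cos θ / (1 + sin θ) and tanh μ = sin θ, so the integrand is real and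
bounded by a, and does not depend on the branch. The modes sin(pθ) exp(-|s|μ) solve the homogeneous
equation off s = 0. Their defect on s = 0 cancels 1 / tanh μ, and orthogonality of sines turns it
into the point source (`realFormula_interior`). Uniqueness is a maximum principle: for bounded
subharmonic H, the supremum over row p is midpoint convex in p and bounded, so it cannot rise above
its value at p = 0. For the walk, the departure probabilities obey the same recursion in time.
Nonnegativity of the formula gives, by induction, that it dominates all partial sums
(`IsDiagonalSteps.sum_departureProb_le`). Their limit is then a bounded solution, equal to the
formula by uniqueness. -/

namespace DiagonalWalk

/-! ### Maximum principle and uniqueness -/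

/-- A midpoint-convex sequence that is bounded above and starts at a nonpositive value is
nonpositive. -/
theorem nonpos_of_convex_of_bounded {M : ℕ → ℝ} {C : ℝ} (h0 : M 0 ≤ 0) (hC : ∀ n, M n ≤ C)
    (hM : ∀ n, 2 * M (n + 1) ≤ M (n + 2) + M n) (n : ℕ) : M n ≤ 0 := by
  have mono : ∀ n k, M (n + 1) - M n ≤ M (n + k + 1) - M (n + k) := by
    intro n k
    induction k with
    | zero => simp
    | succ k ih =>
      have := hM (n + k)
      rw [show n + (k + 1) + 1 = n + k + 2 by ring, show n + (k + 1) = n + k + 1 by ring]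
      linarith
  -- By convexity a positive increment would persist and force linear growth past C.
  have decr : ∀ n, M (n + 1) ≤ M n := by
    intro n
    by_contra! h
    have grow : ∀ k : ℕ, M n + k * (M (n + 1) - M n) ≤ M (n + k) := by
      intro k
      induction k with
      | zero => simp
      | succ k ih =>
        have := mono n k
        rw [← add_assoc]
        push_cast
        linarith
    obtain ⟨k, hk⟩ := exists_nat_gt ((C - M n) / (M (n + 1) - M n))
    rw [div_lt_iff₀ (by linarith)] at hk
    linarith [grow k, hC (n + k)]
  induction n with
  | zero => exact h0
  | succ n ih => exact (decr n).trans ih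

/-- The maximum principle on the half-plane for functions that are bounded above. -/
theorem nonpos_of_subharmonic {H : ℤ → ℤ → ℝ} {C : ℝ} (hC : ∀ p s, 0 ≤ p → H p s ≤ C)
    (h0 : ∀ s, H 0 s ≤ 0)
    (hH : ∀ p s, 1 ≤ p → H p s ≤ 1 / 4 * (H (p + 1) (s + 1) + H (p + 1) (s - 1) +
      H (p - 1) (s + 1) + H (p - 1) (s - 1)))
    (p s : ℤ) (hp : 0 ≤ p) : H p s ≤ 0 := by
  have bdd : ∀ n : ℕ, BddAbove (Set.range (H n)) := fun n =>
    ⟨C, by rintro _ ⟨s, rfl⟩; exact hC _ _ (by positivity)⟩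
  have le : ∀ (n : ℕ) (s : ℤ), H n s ≤ ⨆ s, H n s := fun n s => le_ciSup (bdd n) s
  have key := nonpos_of_convex_of_bounded (M := fun n => ⨆ s, H n s) (C := C)
    (ciSup_le fun s => by simpa using h0 s)
    (fun n => ciSup_le fun s => hC _ _ (by positivity)) (fun n => by
      rw [← le_div_iff₀' two_pos]
      refine ciSup_le fun s => ?_
      have h := hH (n + 1 : ℕ) s (by push_cast; omega)
      have e1 : ((n + 1 : ℕ) : ℤ) + 1 = (n + 2 : ℕ) := by push_cast; ring
      have e2 : ((n + 1 : ℕ) : ℤ) - 1 = n := by push_cast; ring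
      rw [e1, e2] at h
      linarith [le (n + 2) (s + 1), le (n + 2) (s - 1), le n (s + 1), le n (s - 1)])
  lift p to ℕ using hp
  exact (le p s).trans (key p)

/-- A bounded solution is determined by the source. -/
theorem IsSolution.eq_of_isBounded {a : ℤ} {G₁ G₂ : ℤ → ℤ → ℂ} (h₁ : IsSolution a G₁)
    (h₂ : IsSolution a G₂) (b₁ : IsBoundedOnHalfPlane G₁) (b₂ : IsBoundedOnHalfPlane G₂)
    (p s : ℤ) (hp : 0 ≤ p) : G₁ p s = G₂ p s := by
  obtain ⟨C₁, b₁⟩ := b₁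
  obtain ⟨C₂, b₂⟩ := b₂
  -- The sources cancel, so the norm of the difference is subharmonic.
  have := nonpos_of_subharmonic (H := fun p s => ‖G₁ p s - G₂ p s‖) (C := C₁ + C₂)
    (fun p s hp => (norm_sub_le _ _).trans (add_le_add (b₁ p s hp) (b₂ p s hp)))
    (fun s => by simp [h₁.boundary, h₂.boundary])
    (fun p s hp => by
      have e : G₁ p s - G₂ p s = 1 / 4 * ((G₁ (p + 1) (s + 1) - G₂ (p + 1) (s + 1)) +
          (G₁ (p + 1) (s - 1) - G₂ (p + 1) (s - 1)) + (G₁ (p - 1) (s + 1) - G₂ (p - 1) (s + 1)) +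
          (G₁ (p - 1) (s - 1) - G₂ (p - 1) (s - 1))) := by
        rw [h₁.interior p s hp, h₂.interior p s hp]; ring
      rw [e, norm_mul]
      norm_num
      refine (norm_add_le _ _).trans ?_
      gcongr
      refine (norm_add_le _ _).trans ?_
      gcongr
      exact norm_add_le _ _) p s hp
  exact sub_eq_zero.1 (norm_le_zero_iff.1 this)

/-! ### Elimination of the branch -/

/-- The value of `exp (-μ)` for a branch `μ`, in a form that is regular at `π / 2`. -/
noncomputable def decay (θ : ℝ) : ℝ := Real.cos θ / (1 + Real.sin θ)

/-- The integrand of the integral formula without reference to a branch. -/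
noncomputable def realIntegrand (a p s : ℤ) (θ : ℝ) : ℝ :=
  Real.sin (a * θ) / Real.sin θ * Real.sin (p * θ) * decay θ ^ s.natAbs

/-- The right-hand side of the integral formula without reference to a branch. -/
noncomputable def realFormula (a p s : ℤ) : ℝ :=
  2 / Real.pi * ∫ θ in (0 : ℝ)..Real.pi, realIntegrand a p s θ

/-- This is cos θ cosh μ = 1 multiplied by 2w, with w = exp(-μ). -/
theorem decay_quadratic {θ : ℝ} (h : 0 < Real.sin θ) :
    Real.cos θ * (decay θ ^ 2 + 1) = 2 * decay θ := by
  have := Real.sin_sq_add_cos_sq θ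
  unfold decay
  field_simp
  linear_combination Real.cos θ * this

theorem cos_mul_decay {θ : ℝ} (h : 0 < Real.sin θ) : Real.cos θ * decay θ = 1 - Real.sin θ := by
  have := Real.sin_sq_add_cos_sq θ
  unfold decay
  field_simp
  linear_combination this

theorem abs_decay_lt_one {θ : ℝ} (h : 0 < Real.sin θ) : |decay θ| < 1 := by
  rw [decay, abs_div, abs_of_pos (by linarith : 0 < 1 + Real.sin θ), div_lt_one (by linarith)]
  linarith [Real.abs_cos_le_one θ]

theorem cos_ne_zero_of_mem_Ioo {θ : ℝ} (h : θ ∈ Set.Ioo 0 Real.pi) (h2 : θ ≠ Real.pi / 2) :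
    Real.cos θ ≠ 0 := fun h0 => h2 (Real.injOn_cos (Set.Ioo_subset_Icc_self h)
      ⟨by positivity, by linarith [Real.pi_pos]⟩ (by rw [h0, Real.cos_pi_div_two]))

theorem exists_isBranch : ∃ μ : ℝ → ℂ, IsBranch μ := by
  -- For θ > π/2 the argument is negative, and the complex logarithm supplies the imaginary part.
  refine ⟨fun θ => -Complex.log (decay θ), fun θ hθ h2 => ?_⟩
  have hs := Real.sin_pos_of_mem_Ioo hθ
  have hc := cos_ne_zero_of_mem_Ioo hθ h2
  have hd : decay θ ≠ 0 := div_ne_zero hc (by linarith)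
  have hd' : (decay θ : ℂ) ≠ 0 := by exact_mod_cast hd
  constructor
  · have hq : (Real.cos θ : ℂ) * ((decay θ : ℂ) ^ 2 + 1) = 2 * decay θ := by
      exact_mod_cast decay_quadratic hs
    rw [Complex.cosh_neg, Complex.cosh, Complex.exp_neg, Complex.exp_log hd',
      ← Complex.ofReal_cos]
    field_simp
    linear_combination hq
  · rw [Complex.neg_re, Complex.log_re, Complex.norm_real, Real.norm_eq_abs, neg_pos]
    exact Real.log_neg (abs_pos.2 hd) (abs_decay_lt_one hs)

theorem IsBranch.exp_neg_eq {μ : ℝ → ℂ} (hμ : IsBranch μ) {θ : ℝ} (hθ : θ ∈ Set.Ioo 0 Real.pi)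
    (h2 : θ ≠ Real.pi / 2) : Complex.exp (-μ θ) = decay θ := by
  obtain ⟨h, hre⟩ := hμ θ hθ h2
  have hs := Real.sin_pos_of_mem_Ioo hθ
  have hc : (Real.cos θ : ℂ) ≠ 0 := by exact_mod_cast cos_ne_zero_of_mem_Ioo hθ h2
  have hq : (Real.cos θ : ℂ) * decay θ = 1 - Real.sin θ := by exact_mod_cast cos_mul_decay hs
  have hsc : (Real.sin θ : ℂ) ^ 2 + (Real.cos θ : ℂ) ^ 2 = 1 := by
    exact_mod_cast Real.sin_sq_add_cos_sq θ
  have hw := Complex.exp_ne_zero (-μ θ)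
  rw [← Complex.ofReal_cos, Complex.cosh, ← neg_neg (μ θ), Complex.exp_neg (-μ θ), neg_neg] at h
  set w := Complex.exp (-μ θ) with hwdef
  field_simp at h
  -- The quadratic for w has roots (1 ∓ sin θ) / cos θ; Re μ > 0 means |w| < 1, which excludes the
  -- larger one.
  have hprod : (Real.cos θ * w - (1 - Real.sin θ)) * (Real.cos θ * w - (1 + Real.sin θ)) = 0 := by
    linear_combination Real.cos θ * h - hsc
  rcases mul_eq_zero.1 hprod with h1 | h1
  · exact mul_left_cancel₀ hc (by rw [hq]; linear_combination h1)
  · exfalso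
    have hlt : ‖w‖ < 1 := by
      rw [hwdef, Complex.norm_exp, Complex.neg_re, Real.exp_lt_one_iff]
      linarith
    have hn : |Real.cos θ| * ‖w‖ = 1 + Real.sin θ := by
      have := congrArg norm (sub_eq_zero.1 h1)
      rw [norm_mul, Complex.norm_real, Real.norm_eq_abs] at this
      rw [this, ← Complex.ofReal_one, ← Complex.ofReal_add, Complex.norm_real, Real.norm_eq_abs,
        abs_of_pos (by linarith)]
    nlinarith [Real.abs_cos_le_one θ, abs_nonneg (Real.cos θ), norm_nonneg w]

theorem IsBranch.tanh_eq {μ : ℝ → ℂ} (hμ : IsBranch μ) {θ : ℝ} (hθ : θ ∈ Set.Ioo 0 Real.pi)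
    (h2 : θ ≠ Real.pi / 2) : Complex.tanh (μ θ) = Real.sin θ := by
  have h := (hμ θ hθ h2).1
  have hs := Real.sin_pos_of_mem_Ioo hθ
  have hq : (Real.cos θ : ℂ) * decay θ = 1 - Real.sin θ := by exact_mod_cast cos_mul_decay hs
  have he : Complex.sinh (μ θ) = Complex.cosh (μ θ) - decay θ := by
    rw [← hμ.exp_neg_eq hθ h2, ← Complex.cosh_sub_sinh]; ring
  have hch : Complex.cosh (μ θ) ≠ 0 := right_ne_zero_of_mul_eq_one h
  rw [← Complex.ofReal_cos] at h
  rw [Complex.tanh_eq_sinh_div_cosh, he, div_eq_iff hch]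
  linear_combination (decay θ : ℂ) * h - Complex.cosh (μ θ) * hq

theorem IsBranch.integrand_eq {μ : ℝ → ℂ} (hμ : IsBranch μ) (a p s : ℤ) {θ : ℝ}
    (hθ : θ ∈ Set.Ioo 0 Real.pi) (h2 : θ ≠ Real.pi / 2) :
    integrand μ a p s θ = realIntegrand a p s θ := by
  have he : Complex.exp (-((|s| : ℤ) : ℂ) * μ θ) = (decay θ : ℂ) ^ s.natAbs := by
    rw [← hμ.exp_neg_eq hθ h2, ← Complex.exp_nat_mul, Int.abs_eq_natAbs,
      Int.cast_natCast, neg_mul, mul_neg]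
  rw [integrand, realIntegrand, he, hμ.tanh_eq hθ h2]
  push_cast
  ring

theorem IsBranch.integrand_ae_eq {μ : ℝ → ℂ} (hμ : IsBranch μ) (a p s : ℤ) :
    integrand μ a p s =ᵐ[volume.restrict (Set.uIoc 0 Real.pi)]
      fun θ => (realIntegrand a p s θ : ℂ) := by
  rw [Set.uIoc_of_le Real.pi_pos.le, ← restrict_Ioo_eq_restrict_Ioc]
  have h : ∀ᵐ θ ∂(volume.restrict (Set.Ioo 0 Real.pi)), θ ≠ Real.pi / 2 :=
    ae_restrict_of_ae (Measure.ae_ne volume _)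
  filter_upwards [h, ae_restrict_mem measurableSet_Ioo] with θ h2 hθ
  exact hμ.integrand_eq a p s hθ h2

/-! ### Bounds and integrability -/

theorem abs_sin_nat_mul_le (n : ℕ) (θ : ℝ) : |Real.sin (n * θ)| ≤ n * |Real.sin θ| := by
  induction n with
  | zero => simp
  | succ n ih =>
    push_cast
    rw [add_mul, one_mul, Real.sin_add]
    refine (abs_add_le _ _).trans ?_
    rw [abs_mul, abs_mul, add_mul, one_mul]
    exact add_le_add ((mul_le_of_le_one_right (abs_nonneg _) (Real.abs_cos_le_one _)).trans ih)
      (mul_le_of_le_one_left (abs_nonneg _) (Real.abs_cos_le_one _))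

theorem abs_realIntegrand_le {a : ℤ} (ha : 1 ≤ a) (p s : ℤ) {θ : ℝ}
    (hθ : θ ∈ Set.Ioo 0 Real.pi) : |realIntegrand a p s θ| ≤ a := by
  have hs := Real.sin_pos_of_mem_Ioo hθ
  lift a to ℕ using by omega
  have h1 : |Real.sin ((a : ℤ) * θ) / Real.sin θ| ≤ a := by
    rw [abs_div, div_le_iff₀ (abs_pos.2 hs.ne')]
    exact_mod_cast abs_sin_nat_mul_le a θ
  have h2 : |decay θ ^ s.natAbs| ≤ 1 := by
    rw [abs_pow]
    exact pow_le_one₀ (abs_nonneg _) (abs_decay_lt_one hs).le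
  rw [realIntegrand, abs_mul, abs_mul]
  exact (mul_le_of_le_one_right (by positivity) h2).trans
    ((mul_le_of_le_one_right (by positivity) (Real.abs_sin_le_one _)).trans (by exact_mod_cast h1))

theorem intervalIntegrable_realIntegrand {a : ℤ} (ha : 1 ≤ a) (p s : ℤ) :
    IntervalIntegrable (realIntegrand a p s) volume 0 Real.pi := by
  rw [intervalIntegrable_iff_integrableOn_Ioo_of_le Real.pi_pos.le]
  refine Measure.integrableOn_of_bounded (M := a) (by simp) ?_ ?_
  · have : Measurable (realIntegrand a p s) := by
      unfold realIntegrand decay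
      fun_prop
    exact this.aestronglyMeasurable
  · filter_upwards [ae_restrict_mem measurableSet_Ioo] with θ hθ
    exact abs_realIntegrand_le ha p s hθ

theorem IsBranch.intervalIntegrable {μ : ℝ → ℂ} (hμ : IsBranch μ) {a : ℤ} (ha : 1 ≤ a)
    (p s : ℤ) : IntervalIntegrable (integrand μ a p s) volume 0 Real.pi :=
  IntervalIntegrable.congr_ae
    (intervalIntegrable_iff.2 (intervalIntegrable_realIntegrand ha p s).def'.ofReal)
    (hμ.integrand_ae_eq a p s).symm

theorem IsBranch.formula_eq {μ : ℝ → ℂ} (hμ : IsBranch μ) (a p s : ℤ) :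
    formula μ a p s = realFormula a p s := by
  rw [formula, realFormula, intervalIntegral.integral_congr_ae_restrict (hμ.integrand_ae_eq a p s),
    intervalIntegral.integral_ofReal]
  push_cast
  ring

theorem abs_realFormula_le {a : ℤ} (ha : 1 ≤ a) (p s : ℤ) : |realFormula a p s| ≤ 2 * a := by
  have h : ‖∫ θ in (0 : ℝ)..Real.pi, realIntegrand a p s θ‖ ≤ a * |Real.pi - 0| := by
    refine intervalIntegral.norm_integral_le_of_norm_le_const_ae ?_
    filter_upwards [Measure.ae_ne volume Real.pi] with θ h hθ
    rw [Set.uIoc_of_le Real.pi_pos.le] at hθ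
    exact abs_realIntegrand_le ha p s ⟨hθ.1, lt_of_le_of_ne hθ.2 h⟩
  rw [sub_zero, abs_of_pos Real.pi_pos, Real.norm_eq_abs] at h
  rw [realFormula, abs_mul, abs_of_pos (by positivity), div_mul_eq_mul_div,
    div_le_iff₀ Real.pi_pos]
  linarith

/-! ### Difference equation for the formula -/

theorem integral_cos_int_mul (k : ℤ) :
    ∫ θ in (0 : ℝ)..Real.pi, Real.cos (k * θ) = if k = 0 then Real.pi else 0 := by
  split_ifs with hk
  · simp [hk]
  · have hk' : (k : ℝ) ≠ 0 := by exact_mod_cast hk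
    rw [intervalIntegral.integral_comp_mul_left (fun x => Real.cos x) hk', integral_cos]
    simp [Real.sin_int_mul_pi]

theorem integral_sin_mul_sin {a p : ℤ} (ha : 1 ≤ a) (hp : 1 ≤ p) :
    ∫ θ in (0 : ℝ)..Real.pi, Real.sin (a * θ) * Real.sin (p * θ) =
      if a = p then Real.pi / 2 else 0 := by
  have h : ∀ θ : ℝ, Real.sin (a * θ) * Real.sin (p * θ) =
      1 / 2 * (Real.cos ((a - p : ℤ) * θ) - Real.cos ((a + p : ℤ) * θ)) := by
    intro θ
    push_cast
    rw [sub_mul, add_mul, Real.cos_sub, Real.cos_add]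
    ring
  simp_rw [h]
  rw [intervalIntegral.integral_const_mul, intervalIntegral.integral_sub
    (Continuous.intervalIntegrable (by fun_prop) _ _)
    (Continuous.intervalIntegrable (by fun_prop) _ _), integral_cos_int_mul, integral_cos_int_mul,
    if_neg (by omega : a + p ≠ 0)]
  simp only [sub_eq_zero, sub_zero]
  split_ifs <;> ring

/-- Off s = 0 this is a power of `decay` times `decay_quadratic`. At s = 0 both neighbours have
exponent 1, which leaves the defect 2 sin θ. -/
theorem cos_mul_decay_pow_add (s : ℤ) {θ : ℝ} (h : 0 < Real.sin θ) :
    Real.cos θ * (decay θ ^ (s + 1).natAbs + decay θ ^ (s - 1).natAbs) =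
      2 * decay θ ^ s.natAbs - if 0 = s then 2 * Real.sin θ else 0 := by
  have hq := decay_quadratic h
  rcases lt_trichotomy s 0 with hs | rfl | hs
  · obtain ⟨n, rfl⟩ : ∃ n : ℕ, s = -(n + 1) := ⟨(-s - 1).toNat, by omega⟩
    rw [show (-((n : ℤ) + 1) + 1).natAbs = n by omega, show (-((n : ℤ) + 1) - 1).natAbs = n + 2 by omega,
      show (-((n : ℤ) + 1)).natAbs = n + 1 by omega, if_neg (by omega)]
    linear_combination decay θ ^ n * hq
  · simp
    linear_combination 2 * cos_mul_decay h
  · obtain ⟨n, rfl⟩ : ∃ n : ℕ, s = n + 1 := ⟨(s - 1).toNat, by omega⟩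
    rw [show ((n : ℤ) + 1 + 1).natAbs = n + 2 by omega, show ((n : ℤ) + 1 - 1).natAbs = n by omega,
      show ((n : ℤ) + 1).natAbs = n + 1 by omega, if_neg (by omega)]
    linear_combination decay θ ^ n * hq

theorem realIntegrand_interior (a p s : ℤ) {θ : ℝ} (hθ : θ ∈ Set.Ioo 0 Real.pi) :
    realIntegrand a p s θ - 1 / 4 * (realIntegrand a (p + 1) (s + 1) θ +
        realIntegrand a (p + 1) (s - 1) θ + realIntegrand a (p - 1) (s + 1) θ +
        realIntegrand a (p - 1) (s - 1) θ) =
      (if 0 = s then 1 else 0) * (Real.sin (a * θ) * Real.sin (p * θ)) := by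
  have hs := Real.sin_pos_of_mem_Ioo hθ
  have h := cos_mul_decay_pow_add s hs
  have h1 : Real.sin (((p + 1 : ℤ) : ℝ) * θ) + Real.sin (((p - 1 : ℤ) : ℝ) * θ) =
      2 * Real.sin (p * θ) * Real.cos θ := by
    push_cast
    rw [add_mul, sub_mul, one_mul, Real.sin_add, Real.sin_sub]
    ring
  have h2 : Real.sin (a * θ) / Real.sin θ * Real.sin θ = Real.sin (a * θ) :=
    div_mul_cancel₀ _ hs.ne'
  unfold realIntegrand
  set u := Real.sin (a * θ) / Real.sin θ
  rw [← h2]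
  have h3 : (if 0 = s then 2 * Real.sin θ else 0) = 2 * ((if 0 = s then 1 else 0) * Real.sin θ) := by
    split_ifs <;> ring
  rw [h3] at h
  linear_combination (-1 / 4 * u * (decay θ ^ (s + 1).natAbs + decay θ ^ (s - 1).natAbs)) * h1 -
    (1 / 2 * u * Real.sin (p * θ)) * h

theorem realFormula_interior {a : ℤ} (ha : 1 ≤ a) (p s : ℤ) (hp : 1 ≤ p) :
    realFormula a p s = (if a = p then 1 else 0) * (if (0 : ℤ) = s then 1 else 0) +
      1 / 4 * (realFormula a (p + 1) (s + 1) + realFormula a (p + 1) (s - 1) +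
        realFormula a (p - 1) (s + 1) + realFormula a (p - 1) (s - 1)) := by
  have I := intervalIntegrable_realIntegrand ha
  have h : ∫ θ in (0 : ℝ)..Real.pi, (realIntegrand a p s θ -
      1 / 4 * (realIntegrand a (p + 1) (s + 1) θ + realIntegrand a (p + 1) (s - 1) θ +
        realIntegrand a (p - 1) (s + 1) θ + realIntegrand a (p - 1) (s - 1) θ)) =
      ∫ θ in (0 : ℝ)..Real.pi,
        (if 0 = s then 1 else 0) * (Real.sin (a * θ) * Real.sin (p * θ)) := by
    refine intervalIntegral.integral_congr_ae ?_
    filter_upwards [Measure.ae_ne volume Real.pi] with θ h hθ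
    rw [Set.uIoc_of_le Real.pi_pos.le] at hθ
    exact realIntegrand_interior a p s ⟨hθ.1, lt_of_le_of_ne hθ.2 h⟩
  rw [intervalIntegral.integral_const_mul, integral_sin_mul_sin ha hp,
    intervalIntegral.integral_sub (I _ _)
      (((((I _ _).add (I _ _)).add (I _ _)).add (I _ _)).const_mul _),
    intervalIntegral.integral_const_mul,
    intervalIntegral.integral_add (((I _ _).add (I _ _)).add (I _ _)) (I _ _),
    intervalIntegral.integral_add ((I _ _).add (I _ _)) (I _ _),
    intervalIntegral.integral_add (I _ _) (I _ _)] at h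
  have e : (if a = p then (1 : ℝ) else 0) = 2 / Real.pi * (if a = p then Real.pi / 2 else 0) := by
    have := Real.pi_ne_zero
    split_ifs
    · field_simp
    · simp
  rw [e]
  unfold realFormula
  linear_combination (2 / Real.pi) * h

theorem realFormula_boundary (a s : ℤ) : realFormula a 0 s = 0 := by
  simp [realFormula, realIntegrand]

theorem IsBranch.isSolution_formula {μ : ℝ → ℂ} (hμ : IsBranch μ) {a : ℤ} (ha : 1 ≤ a) :
    IsSolution a (formula μ a) where
  interior p s hp := by
    simp only [hμ.formula_eq]
    rw [realFormula_interior ha p s hp]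
    split_ifs <;> push_cast <;> ring
  boundary s := by rw [hμ.formula_eq, realFormula_boundary, Complex.ofReal_zero]

theorem IsBranch.isBounded_formula {μ : ℝ → ℂ} (hμ : IsBranch μ) {a : ℤ} (ha : 1 ≤ a) :
    IsBoundedOnHalfPlane (formula μ a) :=
  ⟨2 * a, fun p s _ => by
    rw [hμ.formula_eq, Complex.norm_real]
    exact abs_realFormula_le ha p s⟩

/-- The source is nonnegative, so minus the formula is subharmonic; the sign is not visible from the
integral. -/
theorem realFormula_nonneg {a : ℤ} (ha : 1 ≤ a) (p s : ℤ) (hp : 0 ≤ p) :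
    0 ≤ realFormula a p s := by
  rw [← neg_nonpos]
  refine nonpos_of_subharmonic (H := fun p s => -realFormula a p s) (C := 2 * a)
    (fun p s _ => (neg_le_abs _).trans (abs_realFormula_le ha p s))
    (fun s => by simp [realFormula_boundary]) (fun p s hp => ?_) p s hp
  have h := realFormula_interior ha p s hp
  have : (0 : ℝ) ≤ (if a = p then 1 else 0) * (if (0 : ℤ) = s then 1 else 0) := by positivity
  linarith


/-! ### The law of the walk -/

/-- The position at time `n` is a function of the first `n` steps. -/
theorem exists_walk_eq {Ω : Type*} (ξ : ℕ → Ω → ℤ × ℤ) (x₀ : ℤ × ℤ) (n : ℕ) :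
    ∃ f : (Finset.range n → ℤ × ℤ) → ℤ × ℤ, ∀ ω, walk ξ x₀ n ω = f fun i => ξ i ω := by
  induction n with
  | zero => exact ⟨fun _ => x₀, fun _ => rfl⟩
  | succ n ih =>
    obtain ⟨f, hf⟩ := ih
    let r : (Finset.range (n + 1) → ℤ × ℤ) → Finset.range n → ℤ × ℤ :=
      fun v i => v ⟨i, Finset.range_subset_range.2 n.le_succ i.2⟩
    refine ⟨fun v => if 1 ≤ (f (r v)).1 then f (r v) + v ⟨n, Finset.self_mem_range_succ n⟩
      else f (r v), fun ω => ?_⟩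
    rw [walk, hf]

variable {Ω : Type*} [MeasurableSpace Ω] {P : Measure Ω} {ξ : ℕ → Ω → ℤ × ℤ}

theorem IsDiagonalSteps.measurable_walk (h : IsDiagonalSteps P ξ) (x₀ : ℤ × ℤ) (n : ℕ) :
    Measurable (walk ξ x₀ n) := by
  obtain ⟨f, hf⟩ := exists_walk_eq ξ x₀ n
  rw [funext hf]
  exact (Measurable.of_discrete (f := f)).comp (measurable_pi_lambda _ fun i => h.measurable i)

theorem IsDiagonalSteps.indepFun_walk (h : IsDiagonalSteps P ξ) (x₀ : ℤ × ℤ) (n : ℕ) :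
    IndepFun (walk ξ x₀ n) (ξ n) P := by
  obtain ⟨f, hf⟩ := exists_walk_eq ξ x₀ n
  rw [funext hf]
  exact (h.indep.indepFun_finset (Finset.range n) {n} (by simp) h.measurable).comp
    (φ := f) (ψ := fun v => v ⟨n, Finset.mem_singleton_self n⟩)
    Measurable.of_discrete Measurable.of_discrete

theorem IsDiagonalSteps.measureReal_walk_inter_step (h : IsDiagonalSteps P ξ) (x₀ y e : ℤ × ℤ)
    (n : ℕ) (h1 : |e.1| = 1) (h2 : |e.2| = 1) :
    P.real (walk ξ x₀ n ⁻¹' {y} ∩ ξ n ⁻¹' {e}) = 1 / 4 * P.real (walk ξ x₀ n ⁻¹' {y}) := by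
  rw [measureReal_def, (h.indepFun_walk x₀ n).measure_inter_preimage_eq_mul _ _
    (measurableSet_singleton y) (measurableSet_singleton e), h.law n e h1 h2, ENNReal.toReal_mul,
    measureReal_def, mul_comm]
  simp

/-- Almost surely all steps are diagonal. -/
theorem IsDiagonalSteps.ae_step [IsProbabilityMeasure P] (h : IsDiagonalSteps P ξ) (n : ℕ) :
    ∀ᵐ ω ∂P, ξ n ω = (1, 1) ∨ ξ n ω = (1, -1) ∨ ξ n ω = (-1, 1) ∨ ξ n ω = (-1, -1) := by
  have hm := fun e : ℤ × ℤ => h.measurable n (measurableSet_singleton e)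
  -- Four disjoint events of mass 1/4 exhaust the probability.
  have hS : P (ξ n ⁻¹' {(1, 1)} ∪ (ξ n ⁻¹' {(1, -1)} ∪ (ξ n ⁻¹' {(-1, 1)} ∪
      ξ n ⁻¹' {(-1, -1)}))) = 1 := by
    rw [measure_union _ ((hm _).union ((hm _).union (hm _))),
      measure_union _ ((hm _).union (hm _)), measure_union _ (hm _),
      h.law n _ (by simp) (by simp), h.law n _ (by simp) (by simp),
      h.law n _ (by simp) (by simp), h.law n _ (by simp) (by simp)]
    · rw [← ENNReal.toReal_eq_one_iff]
      rw [ENNReal.toReal_add, ENNReal.toReal_add, ENNReal.toReal_add] <;> simp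
      norm_num
    all_goals
      rw [Set.disjoint_left]
      intro ω hω
      simp only [Set.mem_preimage, Set.mem_singleton_iff, Set.mem_union] at hω ⊢
      simp [hω]
  have := (prob_compl_eq_zero_iff ((hm _).union ((hm _).union ((hm _).union (hm _))))).2 hS
  rw [ae_iff]
  convert this using 2
  ext ω
  simp

/-! ### Departure probabilities -/

/-- The probability that the walk leaves the point `(p, s)` at time `n`. -/
noncomputable def departureProb (P : Measure Ω) (ξ : ℕ → Ω → ℤ × ℤ) (x₀ : ℤ × ℤ) (n : ℕ)
    (p s : ℤ) : ℝ :=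
  if 1 ≤ p then P.real (walk ξ x₀ n ⁻¹' {(p, s)}) else 0

theorem departureProb_nonneg (P : Measure Ω) (ξ : ℕ → Ω → ℤ × ℤ) (x₀ : ℤ × ℤ) (n : ℕ)
    (p s : ℤ) : 0 ≤ departureProb P ξ x₀ n p s := by
  unfold departureProb
  split_ifs <;> positivity

theorem departureProb_zero [IsProbabilityMeasure P] (a p s : ℤ) (hp : 1 ≤ p) :
    departureProb P ξ (a, 0) 0 p s = (if a = p then 1 else 0) * (if (0 : ℤ) = s then 1 else 0) := by
  have : walk ξ (a, 0) 0 = fun _ => ((a, 0) : ℤ × ℤ) := rfl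
  rw [departureProb, if_pos hp, this, Set.preimage_const]
  by_cases h1 : a = p <;> by_cases h2 : 0 = s <;> simp [h1, h2]

theorem IsDiagonalSteps.measureReal_move [IsProbabilityMeasure P] (h : IsDiagonalSteps P ξ)
    (x₀ y e : ℤ × ℤ) (n : ℕ) (h1 : |e.1| = 1) (h2 : |e.2| = 1) :
    P.real {ω | 1 ≤ (walk ξ x₀ n ω).1 ∧ walk ξ x₀ n ω + ξ n ω = y ∧ ξ n ω = e} =
      1 / 4 * departureProb P ξ x₀ n (y.1 - e.1) (y.2 - e.2) := by
  unfold departureProb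
  split_ifs with hp
  · rw [← h.measureReal_walk_inter_step x₀ _ e n h1 h2]
    congr 1
    ext ω
    simp only [Set.mem_ofPred_eq, Set.mem_inter_iff, Set.mem_preimage, Set.mem_singleton_iff,
      Prod.ext_iff, Prod.fst_add, Prod.snd_add]
    omega
  · convert measureReal_empty
    · ext ω
      simp only [Set.mem_ofPred_eq, Set.mem_empty_iff_false, iff_false, Prod.ext_iff,
        Prod.fst_add, Prod.snd_add]
      omega
    · simp

/-- Forward equation, by the last step. The cutoff in `departureProb` discards absorbed
predecessors. -/
theorem IsDiagonalSteps.departureProb_succ [IsProbabilityMeasure P] (h : IsDiagonalSteps P ξ)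
    (x₀ : ℤ × ℤ) (n : ℕ) (p s : ℤ) (hp : 1 ≤ p) :
    departureProb P ξ x₀ (n + 1) p s = 1 / 4 * (departureProb P ξ x₀ n (p + 1) (s + 1) +
      departureProb P ξ x₀ n (p + 1) (s - 1) + departureProb P ξ x₀ n (p - 1) (s + 1) +
      departureProb P ξ x₀ n (p - 1) (s - 1)) := by
  let A : ℤ × ℤ → Set Ω := fun e =>
    {ω | 1 ≤ (walk ξ x₀ n ω).1 ∧ walk ξ x₀ n ω + ξ n ω = (p, s) ∧ ξ n ω = e}
  have hA : ∀ e, MeasurableSet (A e) := fun e =>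
    (((h.measurable_walk x₀ n).prodMk (h.measurable n)) (MeasurableSet.of_discrete
      (s := {z : (ℤ × ℤ) × (ℤ × ℤ) | 1 ≤ z.1.1 ∧ z.1 + z.2 = (p, s) ∧ z.2 = e})))
  have hd : ∀ e e', e ≠ e' → Disjoint (A e) (A e') := fun e e' hne =>
    Set.disjoint_left.2 fun ω h1 h2 => hne (h1.2.2.symm.trans h2.2.2)
  have hS : walk ξ x₀ (n + 1) ⁻¹' {(p, s)} =ᵐ[P]
      (A (-1, -1) ∪ (A (-1, 1) ∪ (A (1, -1) ∪ A (1, 1))) : Set Ω) := by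
    rw [Filter.eventuallyEq_set]
    filter_upwards [h.ae_step n] with ω hω
    simp only [A, Set.mem_preimage, Set.mem_singleton_iff, Set.mem_union, Set.mem_ofPred_eq, walk]
    split_ifs with h1
    · tauto
    · simp only [h1, false_and, or_self, iff_false]
      rintro h2
      rw [h2] at h1
      exact h1 hp
  rw [departureProb, if_pos hp, measureReal_congr hS,
    measureReal_union (by simp [Set.disjoint_union_right, hd]) ((hA _).union ((hA _).union (hA _))),
    measureReal_union (by simp [Set.disjoint_union_right, hd]) ((hA _).union (hA _)),
    measureReal_union (by simp [hd]) (hA _),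
    h.measureReal_move x₀ _ _ n (by simp) (by simp), h.measureReal_move x₀ _ _ n (by simp) (by simp),
    h.measureReal_move x₀ _ _ n (by simp) (by simp), h.measureReal_move x₀ _ _ n (by simp) (by simp)]
  simp only [sub_neg_eq_add]
  ring

theorem IsDiagonalSteps.sum_departureProb_le [IsProbabilityMeasure P] (h : IsDiagonalSteps P ξ)
    {a : ℤ} (ha : 1 ≤ a) (N : ℕ) (p s : ℤ) (hp : 0 ≤ p) :
    ∑ n ∈ Finset.range N, departureProb P ξ (a, 0) n p s ≤ realFormula a p s := by
  induction N generalizing p s with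
  | zero => simpa using realFormula_nonneg ha p s hp
  | succ N ih =>
    rcases hp.eq_or_lt with rfl | hp
    · simp [departureProb, realFormula_boundary]
    · have hp1 : 1 ≤ p := hp
      -- Time 0 is the source; the later terms average the shorter partial sums at the four
      -- neighbours.
      rw [Finset.sum_range_succ', departureProb_zero a p s hp1, realFormula_interior ha p s hp1,
        Finset.sum_congr rfl fun n _ => h.departureProb_succ (a, 0) n p s hp1, ← Finset.mul_sum,
        Finset.sum_add_distrib, Finset.sum_add_distrib, Finset.sum_add_distrib]
      linarith [ih (p + 1) (s + 1) (by omega), ih (p + 1) (s - 1) (by omega),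
        ih (p - 1) (s + 1) (by omega), ih (p - 1) (s - 1) (by omega)]

theorem IsDiagonalSteps.summable_departureProb [IsProbabilityMeasure P] (h : IsDiagonalSteps P ξ)
    {a : ℤ} (ha : 1 ≤ a) (p s : ℤ) (hp : 0 ≤ p) :
    Summable fun n => departureProb P ξ (a, 0) n p s :=
  summable_of_sum_range_le (fun n => departureProb_nonneg P ξ _ n p s)
    fun N => h.sum_departureProb_le ha N p s hp

theorem IsDiagonalSteps.isSolution_tsum [IsProbabilityMeasure P] (h : IsDiagonalSteps P ξ)
    {a : ℤ} (ha : 1 ≤ a) :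
    IsSolution a fun p s => ((∑' n, departureProb P ξ (a, 0) n p s : ℝ) : ℂ) where
  boundary s := by simp [departureProb]
  interior p s hp := by
    have S := fun p s hp => (h.summable_departureProb ha p s hp)
    have S1 := S (p + 1) (s + 1) (by omega)
    have S2 := S (p + 1) (s - 1) (by omega)
    have S3 := S (p - 1) (s + 1) (by omega)
    have S4 := S (p - 1) (s - 1) (by omega)
    rw [(S p s (by omega)).tsum_eq_zero_add, departureProb_zero a p s hp,
      tsum_congr fun n => h.departureProb_succ (a, 0) n p s hp, tsum_mul_left,
      ((S1.add S2).add S3).tsum_add S4, (S1.add S2).tsum_add S3, S1.tsum_add S2]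
    split_ifs <;> push_cast <;> ring

theorem IsDiagonalSteps.tsum_departureProb [IsProbabilityMeasure P] (h : IsDiagonalSteps P ξ)
    {a : ℤ} (ha : 1 ≤ a) {μ : ℝ → ℂ} (hμ : IsBranch μ) (p s : ℤ) (hp : 0 ≤ p) :
    ((∑' n, departureProb P ξ (a, 0) n p s : ℝ) : ℂ) = formula μ a p s := by
  refine (h.isSolution_tsum ha).eq_of_isBounded (hμ.isSolution_formula ha) ⟨2 * a, ?_⟩
    (hμ.isBounded_formula ha) p s hp
  intro p s hp
  rw [Complex.norm_real, Real.norm_eq_abs,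
    abs_of_nonneg (tsum_nonneg fun n => departureProb_nonneg P ξ _ n p s)]
  exact (Real.tsum_le_of_sum_range_le (fun n => departureProb_nonneg P ξ _ n p s)
    fun N => h.sum_departureProb_le ha N p s hp).trans
      ((le_abs_self _).trans (abs_realFormula_le ha p s))

/-- By Tonelli, it suffices to treat each time separately. Almost every visit to an interior point
is a departure, since diagonal steps are nonzero; an absorbed walk never departs. -/
theorem IsDiagonalSteps.expectedDepartures_eq [IsProbabilityMeasure P] (h : IsDiagonalSteps P ξ)
    (x₀ : ℤ × ℤ) (p s : ℤ) :
    expectedDepartures P ξ x₀ (p, s) =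
      ∑' n, ENNReal.ofReal (departureProb P ξ x₀ n p s) := by
  classical
  have hm : ∀ n, MeasurableSet
      {ω | walk ξ x₀ n ω = (p, s) ∧ walk ξ x₀ (n + 1) ω ≠ (p, s)} := fun n =>
    (h.measurable_walk x₀ n (measurableSet_singleton _)).inter
      (h.measurable_walk x₀ (n + 1) (measurableSet_singleton _)).compl
  unfold expectedDepartures departures
  rw [lintegral_tsum fun n =>
    (Measurable.ite (hm n) measurable_const measurable_const).aemeasurable]
  refine tsum_congr fun n => ?_
  have hi : (fun ω => if walk ξ x₀ n ω = (p, s) ∧ walk ξ x₀ (n + 1) ω ≠ (p, s) then (1 : ℝ≥0∞)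
      else 0) = Set.indicator
        {ω | walk ξ x₀ n ω = (p, s) ∧ walk ξ x₀ (n + 1) ω ≠ (p, s)} 1 := by
    ext ω
    simp [Set.indicator_apply]
  have hl : (∫⁻ ω, if walk ξ x₀ n ω = (p, s) ∧ walk ξ x₀ (n + 1) ω ≠ (p, s) then (1 : ℝ≥0∞)
      else 0 ∂P) = P {ω | walk ξ x₀ n ω = (p, s) ∧ walk ξ x₀ (n + 1) ω ≠ (p, s)} := by
    rw [hi, lintegral_indicator_one (hm n)]
  convert hl using 1
  unfold departureProb
  split_ifs with hp
  · rw [ofReal_measureReal]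
    refine measure_congr ?_
    rw [Filter.eventuallyEq_set]
    filter_upwards [h.ae_step n] with ω hω
    simp only [Set.mem_preimage, Set.mem_singleton_iff, walk]
    refine ⟨fun hy => ⟨hy, ?_⟩, fun hy => hy.1⟩
    rw [hy, if_pos hp, Ne, add_eq_left]
    rcases hω with hω | hω | hω | hω <;> simp [hω]
  · symm
    rw [ENNReal.ofReal_zero]
    convert measure_empty (μ := P)
    ext ω
    simp only [Set.mem_ofPred_eq, Set.mem_empty_iff_false, iff_false, not_and, not_not, walk]
    intro hy
    rw [hy, if_neg hp]

end DiagonalWalk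

theorem mainTheorem4 (a : ℤ) (ha : 1 ≤ a) :
    (∃ μ : ℝ → ℂ, DiagonalWalk.IsBranch μ) ∧
    ∀ μ : ℝ → ℂ, DiagonalWalk.IsBranch μ →
      -- the integral exists
      (∀ p s : ℤ, 0 ≤ p →
        IntervalIntegrable (DiagonalWalk.integrand μ a p s) volume 0 Real.pi) ∧
      -- it is the expected number of departures, which is finite
      (∀ {Ω : Type*} [MeasurableSpace Ω] (P : Measure Ω) [IsProbabilityMeasure P]
        (ξ : ℕ → Ω → ℤ × ℤ), DiagonalWalk.IsDiagonalSteps P ξ →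
        ∀ p s : ℤ, 0 ≤ p →
          DiagonalWalk.expectedDepartures P ξ (a, 0) (p, s) ≠ ⊤ ∧
          ((DiagonalWalk.expectedDepartures P ξ (a, 0) (p, s)).toReal : ℂ) =
            DiagonalWalk.formula μ a p s) ∧
      -- it is a bounded solution of the boundary value problem
      DiagonalWalk.IsSolution a (DiagonalWalk.formula μ a) ∧
      DiagonalWalk.IsBoundedOnHalfPlane (DiagonalWalk.formula μ a) ∧
      -- and the only one
      (∀ G : ℤ → ℤ → ℂ, DiagonalWalk.IsSolution a G → DiagonalWalk.IsBoundedOnHalfPlane G →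
        ∀ p s : ℤ, 0 ≤ p → G p s = DiagonalWalk.formula μ a p s) := by
  refine ⟨DiagonalWalk.exists_isBranch, fun μ hμ =>
    ⟨fun p s _ => hμ.intervalIntegrable ha p s, fun P _ ξ h p s hp => ?_, hμ.isSolution_formula ha,
      hμ.isBounded_formula ha, fun G hG bG =>
        hG.eq_of_isBounded (hμ.isSolution_formula ha) bG (hμ.isBounded_formula ha)⟩⟩
  rw [h.expectedDepartures_eq,
    ← ENNReal.ofReal_tsum_of_nonneg (DiagonalWalk.departureProb_nonneg P ξ _ · p s)
      (h.summable_departureProb ha p s hp)]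
  refine ⟨ENNReal.ofReal_ne_top, ?_⟩
  rw [ENNReal.toReal_ofReal (tsum_nonneg (DiagonalWalk.departureProb_nonneg P ξ _ · p s)),
    h.tsum_departureProb ha hμ p s hp]
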